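/- For $i\in\{1,2\}$ let $\Sigma_i$ be the linear system $$\dot x_i=A_ix_i+B_iu_i+E_id_i,\quad x_i(0)=x_{i,0},\qquad y_i=C_ix_i,$$ with real matrices, $x_i\in\mathbb R^{n_i}$, $u_i\in\mathbb R^{m}$, $d_i\in\mathbb R^{q_i}$, $y_i\in\mathbb R^{p}$; the matrices $A_i$ need not be Hurwitz and the initial conditions are arbitrary. Write $\mathcal L_2$ for the square-integrable signals on $[0,\infty)$, $\|u\|^2=\int_0^\infty|u(t)|^2\,dt$, and $\operatorname{col}(a,b)$ for the stacked vector. For $\gamma,\delta>0$, the system $\Sigma_2$ is called $(\gamma,\delta)$-similar to $\Sigma_1$ if there exist constants $\epsilon,\eta,\mu>0$ and a matrix $K\succ0$ such that for all initial conditions $x_{1,0},x_{2,0}$, all inputs $u_1,u_2\in\mathcal L_2$ and every disturbance $d_1\in\mathcal L_2$ there exists a disturbance $d_2\in\mathcal L_2$ for which $y_1-y_2\in\mathcal L_2$ and $$\|y_1-y_2\|^2\le\gamma\|u_1-u_2\|^2+(\delta-\epsilon)\|\operatorname{col}(u_1,u_2)\|^2+(\mu-\epsilon)\|d_1\|^2-\eta\|d_2\|^2+x_s^\top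 Kx_s,\qquad x_s=\operatorname{col}(x_{1,0},x_{2,0}).$$ Put $$A=\begin{bmatrix}A_1&0\\0&A_2\end{bmatrix},\quad B=\begin{bmatrix}0\\E_2\end{bmatrix},\quad E=\begin{bmatrix}B_1&0&E_1\\0&B_2&0\end{bmatrix},\quad C=\begin{bmatrix}C_1&-C_2\\0&0\end{bmatrix},\quad D=\begin{bmatrix}0\\I\end{bmatrix},$$ $$Q=\begin{bmatrix}(\gamma+\delta)I&-\gamma I&0\\-\gamma I&(\gamma+\delta)I&0\\0&0&\mu I\end{bmatrix},\qquad R=\begin{bmatrix}I&0\\0&\eta I\end{bmatrix}.$$ Let $\gamma,\delta>0$. If there exist a positive definite matrix $X$, a matrix $\Pi$ and scalars $\eta,\mu>0$ such that $$\begin{bmatrix}AX+B\Pi+(AX+B\Pi)^\top&E&(CX+D\Pi)^\top\\E^\top&-Q&0\\CX+D\Pi&0&-R\end{bmatrix}\prec0,$$ then $\Sigma_2$ is $(\gamma,\delta)$-similar to $\Sigma_1$. No assumption on the zeros of the composite system $\dot x=Ax+Bd_2+Ew$, $z=Cx+Dd_2$ is made; in particular the implication holds when this system has no zeros on the imaginary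 axis. -/

import Mathlib

open MeasureTheory Matrix

noncomputable section

/-- A linear time-invariant system `ẋ = A x + B u + E d`, `y = C x`, with state dimension `n`,
input dimension `m`, disturbance dimension `q` and output dimension `p`.
No stability is required. -/
structure LTISystem (n m q p : ℕ) where
  A : Matrix (Fin n) (Fin n) ℝ
  B : Matrix (Fin n) (Fin m) ℝ
  E : Matrix (Fin n) (Fin q) ℝ
  C : Matrix (Fin p) (Fin n) ℝ

/-- The stacked vector `col(x, y)`. -/
def stack {ι κ : Type} (x : EuclideanSpace ℝ ι) (y : EuclideanSpace ℝ κ) :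
    EuclideanSpace ℝ (ι ⊕ κ) :=
  WithLp.toLp 2 (Sum.elim (fun i => x i) (fun j => y j))

/-- `u ∈ 𝓛₂`: the signal `u` is square integrable on `[0, ∞)`. The values of a signal at negative
times are irrelevant. -/
def IsL2 {ι : Type} [Fintype ι] (u : ℝ → EuclideanSpace ℝ ι) : Prop :=
  MemLp u 2 (volume.restrict (Set.Ici (0 : ℝ)))

/-- The squared norm `‖u‖² = ∫₀^∞ |u(t)|² dt` of a signal. -/
def l2NormSq {ι : Type} [Fintype ι] (u : ℝ → EuclideanSpace ℝ ι) : ℝ :=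
  ∫ t in Set.Ici (0 : ℝ), ‖u t‖ ^ 2

namespace LTISystem

variable {n m q p : ℕ}

/-- The right-hand side `A x + B u + E d` of the state equation. -/
def vectorField (S : LTISystem n m q p) (x : EuclideanSpace ℝ (Fin n))
    (u : EuclideanSpace ℝ (Fin m)) (d : EuclideanSpace ℝ (Fin q)) : EuclideanSpace ℝ (Fin n) :=
  S.A.toEuclideanLin x + S.B.toEuclideanLin u + S.E.toEuclideanLin d

/-- `x` is the (Carathéodory) state trajectory on `[0, ∞)` with `x(0) = x₀` under the input `u` and
the disturbance `d`: it is continuous and satisfies the integrated state equation. For locally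
integrable `u` and `d`, the integrand is locally integrable and `x` is unique on `[0, ∞)`. -/
def IsTrajectory (S : LTISystem n m q p) (x₀ : EuclideanSpace ℝ (Fin n))
    (u : ℝ → EuclideanSpace ℝ (Fin m)) (d : ℝ → EuclideanSpace ℝ (Fin q))
    (x : ℝ → EuclideanSpace ℝ (Fin n)) : Prop :=
  ContinuousOn x (Set.Ici 0) ∧
    ∀ t : ℝ, 0 ≤ t → x t = x₀ + ∫ s in (0 : ℝ)..t, S.vectorField (x s) (u s) (d s)

/-- The output `y = C x`. -/
def output (S : LTISystem n m q p) (x : ℝ → EuclideanSpace ℝ (Fin n)) :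
    ℝ → EuclideanSpace ℝ (Fin p) :=
  fun t => S.C.toEuclideanLin (x t)

end LTISystem

variable {n₁ n₂ m q₁ q₂ p : ℕ}

/-- `S₂` is `(γ, δ)`-similar to `S₁`, for possibly unstable systems and arbitrary initial
conditions. The constants `ε, η, μ` and the matrix `K` depend neither on the initial conditions nor
on the signals. -/
def IsSimilar (S₁ : LTISystem n₁ m q₁ p) (S₂ : LTISystem n₂ m q₂ p) (γ δ : ℝ) : Prop :=
  ∃ (ε η μ : ℝ) (K : Matrix (Fin n₁ ⊕ Fin n₂) (Fin n₁ ⊕ Fin n₂) ℝ),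
    0 < ε ∧ 0 < η ∧ 0 < μ ∧ K.PosDef ∧
    ∀ (x₁₀ : EuclideanSpace ℝ (Fin n₁)) (x₂₀ : EuclideanSpace ℝ (Fin n₂))
      (u₁ u₂ : ℝ → EuclideanSpace ℝ (Fin m)) (d₁ : ℝ → EuclideanSpace ℝ (Fin q₁)),
      IsL2 u₁ → IsL2 u₂ → IsL2 d₁ →
      ∃ (d₂ : ℝ → EuclideanSpace ℝ (Fin q₂))
        (x₁ : ℝ → EuclideanSpace ℝ (Fin n₁)) (x₂ : ℝ → EuclideanSpace ℝ (Fin n₂)),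
        IsL2 d₂ ∧ S₁.IsTrajectory x₁₀ u₁ d₁ x₁ ∧ S₂.IsTrajectory x₂₀ u₂ d₂ x₂ ∧
        IsL2 (fun t => S₁.output x₁ t - S₂.output x₂ t) ∧
        l2NormSq (fun t => S₁.output x₁ t - S₂.output x₂ t) ≤
          γ * l2NormSq (fun t => u₁ t - u₂ t)
            + (δ - ε) * l2NormSq (fun t => stack (u₁ t) (u₂ t))
            + (μ - ε) * l2NormSq d₁ - η * l2NormSq d₂
            + (stack x₁₀ x₂₀).ofLp ⬝ᵥ K *ᵥ (stack x₁₀ x₂₀).ofLp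

/-! The matrices of the composite system `ẋ = A x + B d₂ + E w`, `z = C x + D d₂`, where
`x = col(x₁, x₂)`, `w = col(u₁, u₂, d₁)` and `z = col(y₁ - y₂, d₂)`. -/

def compositeA (S₁ : LTISystem n₁ m q₁ p) (S₂ : LTISystem n₂ m q₂ p) :
    Matrix (Fin n₁ ⊕ Fin n₂) (Fin n₁ ⊕ Fin n₂) ℝ :=
  fromBlocks S₁.A 0 0 S₂.A

def compositeB (_S₁ : LTISystem n₁ m q₁ p) (S₂ : LTISystem n₂ m q₂ p) :
    Matrix (Fin n₁ ⊕ Fin n₂) (Fin q₂) ℝ :=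
  fromRows 0 S₂.E

def compositeE (S₁ : LTISystem n₁ m q₁ p) (S₂ : LTISystem n₂ m q₂ p) :
    Matrix (Fin n₁ ⊕ Fin n₂) ((Fin m ⊕ Fin m) ⊕ Fin q₁) ℝ :=
  fromRows (fromCols (fromCols S₁.B 0) S₁.E) (fromCols (fromCols 0 S₂.B) 0)

def compositeC (S₁ : LTISystem n₁ m q₁ p) (S₂ : LTISystem n₂ m q₂ p) :
    Matrix (Fin p ⊕ Fin q₂) (Fin n₁ ⊕ Fin n₂) ℝ :=
  fromBlocks S₁.C (-S₂.C) 0 0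

def compositeD (_S₁ : LTISystem n₁ m q₁ p) (_S₂ : LTISystem n₂ m q₂ p) :
    Matrix (Fin p ⊕ Fin q₂) (Fin q₂) ℝ :=
  fromRows 0 1

/-- The weight `Q` on `w = col(u₁, u₂, d₁)`. -/
def weightQ (m q₁ : ℕ) (γ δ μ : ℝ) :
    Matrix ((Fin m ⊕ Fin m) ⊕ Fin q₁) ((Fin m ⊕ Fin m) ⊕ Fin q₁) ℝ :=
  fromBlocks
    (fromBlocks ((γ + δ) • 1) (-(γ • 1)) (-(γ • 1)) ((γ + δ) • 1)) 0
    0 (μ • 1)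

/-- The weight `R` on `z = col(y₁ - y₂, d₂)`. -/
def weightR (p q₂ : ℕ) (η : ℝ) : Matrix (Fin p ⊕ Fin q₂) (Fin p ⊕ Fin q₂) ℝ :=
  fromBlocks 1 0 0 (η • 1)

/-- The symmetric `3 × 3` block matrix of the linear matrix inequality, with block rows
`[A X + B Π + (A X + B Π)ᵀ, E, (C X + D Π)ᵀ]`, `[Eᵀ, -Q, 0]` and `[C X + D Π, 0, -R]`. -/
def lmiMatrix (S₁ : LTISystem n₁ m q₁ p) (S₂ : LTISystem n₂ m q₂ p) (γ δ η μ : ℝ)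
    (X : Matrix (Fin n₁ ⊕ Fin n₂) (Fin n₁ ⊕ Fin n₂) ℝ)
    (P : Matrix (Fin q₂) (Fin n₁ ⊕ Fin n₂) ℝ) :
    Matrix (((Fin n₁ ⊕ Fin n₂) ⊕ ((Fin m ⊕ Fin m) ⊕ Fin q₁)) ⊕ (Fin p ⊕ Fin q₂))
      (((Fin n₁ ⊕ Fin n₂) ⊕ ((Fin m ⊕ Fin m) ⊕ Fin q₁)) ⊕ (Fin p ⊕ Fin q₂)) ℝ :=
  let A := compositeA S₁ S₂
  let B := compositeB S₁ S₂
  let E := compositeE S₁ S₂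
  let C := compositeC S₁ S₂
  let D := compositeD S₁ S₂
  fromBlocks
    (fromBlocks (A * X + B * P + (A * X + B * P)ᵀ) E Eᵀ (-weightQ m q₁ γ δ μ))
    (fromRows (C * X + D * P)ᵀ 0)
    (fromCols (C * X + D * P) 0)
    (-weightR p q₂ η)

end

/-!
A matrix `X ≻ 0` solving the linear matrix inequality makes `V(x) = xᵀ X⁻¹ x` a storage function
for the composite system under the static feedback `d₂ = F x`, `F = Π X⁻¹`. Indeed, substituting
`Π = F X` turns the inequality into the bounded real inequality of the closed loop, and its
quadratic form at `(X⁻¹ x, w, R⁻¹ z)` bounds `dV/dt + zᵀ R⁻¹ z` by `wᵀ Q w`. Since the inequality is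
strict, `Q` may be replaced by `Q - ε I`, and integration along the trajectory gives the
similarity estimate with `K = X⁻¹`; as `R⁻¹` weights `d₂` by `η⁻¹`, the constant `η` of the estimate
is the inverse of the one in the matrix inequality.
-/

theorem absolutelyContinuousOnInterval_of_dist_le {X Y : Type*} [PseudoMetricSpace X]
    [PseudoMetricSpace Y] {f : ℝ → X} {g : ℝ → Y} {a b K : ℝ}
    (hg : AbsolutelyContinuousOnInterval g a b)
    (hfg : ∀ s ∈ Set.uIcc a b, ∀ t ∈ Set.uIcc a b, dist (f s) (f t) ≤ K * dist (g s) (g t)) :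
    AbsolutelyContinuousOnInterval f a b := by
  have hlim := Filter.Tendsto.const_mul K hg
  rw [mul_zero] at hlim
  refine squeeze_zero' (.of_forall fun I => Finset.sum_nonneg fun i _ => dist_nonneg) ?_ hlim
  filter_upwards [Filter.mem_inf_of_right (Filter.mem_principal_self _)] with I hI
  rw [Finset.mul_sum]
  exact Finset.sum_le_sum fun i hi => hfg _ (hI.1 i hi).1 _ (hI.1 i hi).2

theorem intervalIntegrable_indicator_Ioi {E : Type*} [NormedAddCommGroup E] {g : ℝ → E}
    (hg : ∀ t, 0 ≤ t → IntervalIntegrable g volume 0 t) (a b : ℝ) :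
    IntervalIntegrable ((Set.Ioi 0).indicator g) volume a b := by
  suffices h : ∀ t, IntervalIntegrable ((Set.Ioi 0).indicator g) volume 0 t from
    (h a).symm.trans (h b)
  intro t
  rcases le_total 0 t with ht | ht
  · refine (hg t ht).congr fun s hs => (Set.indicator_of_mem ?_ g).symm
    exact (Set.uIoc_of_le ht ▸ hs).1
  · refine IntervalIntegrable.congr (f := 0) (fun s hs => (Set.indicator_of_notMem ?_ g).symm) .zero
    exact not_lt.2 (Set.uIoc_of_ge ht ▸ hs).2

section Caratheodory

variable {E : Type*} [NormedAddCommGroup E] [NormedSpace ℝ E]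

theorem absolutelyContinuousOnInterval_of_eq_add_integral {f x : ℝ → E} {a b : ℝ}
    (hf : IntervalIntegrable f volume a b)
    (hx : ∀ t ∈ Set.uIcc a b, x t = x a + ∫ s in a..t, f s) :
    AbsolutelyContinuousOnInterval x a b := by
  have hfa : ∀ t ∈ Set.uIcc a b, IntervalIntegrable f volume a t := fun t ht =>
    hf.mono_set (Set.uIcc_subset_uIcc_left ht)
  refine absolutelyContinuousOnInterval_of_dist_le (K := 1)
    (hf.norm.absolutelyContinuousOnInterval_intervalIntegral Set.left_mem_uIcc)
    fun s hs t ht => ?_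
  rw [one_mul, hx s hs, hx t ht, dist_add_left, dist_eq_norm, Real.dist_eq,
    intervalIntegral.integral_interval_sub_left (hfa s hs) (hfa t ht),
    intervalIntegral.integral_interval_sub_left (hfa s hs).norm (hfa t ht).norm]
  exact intervalIntegral.norm_integral_le_abs_integral_norm

theorem ae_hasDerivAt_of_eq_add_integral [CompleteSpace E] {f x : ℝ → E} {a b : ℝ}
    (hf : IntervalIntegrable f volume a b)
    (hx : ∀ t ∈ Set.uIcc a b, x t = x a + ∫ s in a..t, f s) :
    ∀ᵐ t, t ∈ Set.uIoc a b → HasDerivAt x (f t) t := by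
  filter_upwards [hf.ae_hasDerivAt_integral, Measure.ae_ne volume (max a b)] with t ht htb hmem
  have hprim := (ht (Set.uIoc_subset_uIcc hmem) a Set.left_mem_uIcc).const_add (x a)
  refine hprim.congr_of_eventuallyEq ?_
  filter_upwards [Icc_mem_nhds hmem.1 (hmem.2.lt_of_ne htb)] with s hs using hx s hs

theorem intervalIntegrable_fderiv_and_integral_eq_sub [CompleteSpace E] {f x : ℝ → E} {a b : ℝ}
    (hf : IntervalIntegrable f volume a b)
    (hx : ∀ t ∈ Set.uIcc a b, x t = x a + ∫ s in a..t, f s) {V : E → ℝ} (hV : ContDiff ℝ 1 V) :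
    IntervalIntegrable (fun t => fderiv ℝ V (x t) (f t)) volume a b ∧
      ∫ t in a..b, fderiv ℝ V (x t) (f t) = V (x b) - V (x a) := by
  have hxac := absolutelyContinuousOnInterval_of_eq_add_integral hf hx
  obtain ⟨K, hK⟩ := LocallyLipschitzOn.exists_lipschitzOnWith_of_compact
    (isCompact_uIcc.image_of_continuousOn hxac.continuousOn)
    hV.locallyLipschitz.locallyLipschitzOn
  have hVx : AbsolutelyContinuousOnInterval (V ∘ x) a b :=
    absolutelyContinuousOnInterval_of_dist_le (K := K) hxac fun s hs t ht =>
      hK.dist_le_mul _ (Set.mem_image_of_mem x hs) _ (Set.mem_image_of_mem x ht)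
  have hderiv : ∀ᵐ t, t ∈ Set.uIoc a b → deriv (V ∘ x) t = fderiv ℝ V (x t) (f t) := by
    filter_upwards [ae_hasDerivAt_of_eq_add_integral hf hx] with t ht hmem
    exact ((hV.differentiable one_ne_zero _).hasFDerivAt.comp_hasDerivAt t (ht hmem)).deriv
  refine ⟨hVx.intervalIntegrable_deriv.congr_ae ?_, ?_⟩
  · exact (ae_restrict_iff' measurableSet_uIoc).2 hderiv
  · rw [← intervalIntegral.integral_congr_ae hderiv, hVx.integral_deriv_eq_sub]
    rfl

/-- `x` is a Carathéodory solution on `[0, ∞)` of the initial value problem `ẋ = G(t, x)`,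
`x(0) = x₀`, that is, a continuous solution of the integral equation. Integrability of the
right-hand side along `x` is required, since otherwise the integral is `0` by convention. -/
structure IsCaratheodorySolution (G : ℝ → E → E) (x₀ : E) (x : ℝ → E) : Prop where
  continuousOn : ContinuousOn x (Set.Ici 0)
  intervalIntegrable : ∀ t, 0 ≤ t → IntervalIntegrable (fun s => G s (x s)) volume 0 t
  eq_add_integral : ∀ t, 0 ≤ t → x t = x₀ + ∫ s in (0 : ℝ)..t, G s (x s)

namespace IsCaratheodorySolution

variable {G : ℝ → E → E} {x₀ : E} {x : ℝ → E}

theorem apply_zero (hx : IsCaratheodorySolution G x₀ x) : x 0 = x₀ := by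
  simpa using hx.eq_add_integral 0 le_rfl

theorem map {F : Type*} [NormedAddCommGroup F] [NormedSpace ℝ F] [CompleteSpace E]
    [CompleteSpace F] (hx : IsCaratheodorySolution G x₀ x) (L : E →L[ℝ] F) {H : ℝ → F → F}
    (hL : ∀ t, 0 ≤ t → L (G t (x t)) = H t (L (x t))) :
    IsCaratheodorySolution H (L x₀) fun t => L (x t) := by
  have hcongr : ∀ t, 0 ≤ t → Set.EqOn (fun s => L (G s (x s))) (fun s => H s (L (x s)))
      (Set.uIcc 0 t) := fun t ht s hs => hL s (Set.uIcc_of_le ht ▸ hs).1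
  refine ⟨L.continuous.comp_continuousOn hx.continuousOn, fun t ht => ?_, fun t ht => ?_⟩
  · have hG := hx.intervalIntegrable t ht
    exact IntervalIntegrable.congr ((hcongr t ht).mono Set.uIoc_subset_uIcc)
      ⟨L.integrable_comp hG.1, L.integrable_comp hG.2⟩
  · rw [hx.eq_add_integral t ht, map_add,
      ← L.intervalIntegral_comp_comm (hx.intervalIntegrable t ht),
      intervalIntegral.integral_congr (hcongr t ht)]

end IsCaratheodorySolution

theorem exists_hasDerivAt_eq_clm_add [CompleteSpace E] (L : E →L[ℝ] E) {h : ℝ → E}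
    (hh : Continuous h) (x₀ : E) :
    ∃ z : ℝ → E, z 0 = x₀ ∧ ∀ t, HasDerivAt z (L (z t) + h t) t := by
  let Φ : ℝ → E →L[ℝ] E := fun t => NormedSpace.exp (t • L)
  have hΦ : ∀ t, HasDerivAt Φ (L * Φ t) t := fun t => hasDerivAt_exp_smul_const' L t
  have hΦc : Continuous Φ := continuous_iff_continuousAt.2 fun t => (hΦ t).continuousAt
  have hΦinv : ∀ t, Φ t * Φ (-t) = 1 := fun t => by
    let _ : NormedAlgebra ℚ (E →L[ℝ] E) := NormedAlgebra.restrictScalars ℚ ℝ _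
    simp only [Φ, neg_smul, ← NormedSpace.exp_add_of_commute (Commute.refl (t • L)).neg_right,
      add_neg_cancel, NormedSpace.exp_zero]
  have hc : Continuous fun t => Φ (-t) (h t) := (hΦc.comp continuous_neg).clm_apply hh
  refine ⟨fun t => Φ t (x₀ + ∫ s in (0 : ℝ)..t, Φ (-s) (h s)), by simp [Φ], fun t => ?_⟩
  have hint := (hc.integral_hasStrictDerivAt 0 t).hasDerivAt.const_add x₀
  convert (hΦ t).clm_apply hint using 1
  rw [← mul_apply_eq_comp (Φ t), hΦinv]
  rfl

theorem exists_isCaratheodorySolution_clm_add [CompleteSpace E] (L : E →L[ℝ] E) {g : ℝ → E}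
    (hg : ∀ t, 0 ≤ t → IntervalIntegrable g volume 0 t) (x₀ : E) :
    ∃ x : ℝ → E, IsCaratheodorySolution (fun t v => L v + g t) x₀ x := by
  let W : ℝ → E := fun t => ∫ s in (0 : ℝ)..t, (Set.Ioi (0 : ℝ)).indicator g s
  have hW : Continuous W :=
    intervalIntegral.continuous_primitive (intervalIntegrable_indicator_Ioi hg) 0
  have hWg : ∀ t, 0 ≤ t → W t = ∫ s in (0 : ℝ)..t, g s := fun t ht => by
    refine intervalIntegral.integral_congr_ae (.of_forall fun s hs => Set.indicator_of_mem ?_ g)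
    exact (Set.uIoc_of_le ht ▸ hs).1
  -- Subtracting the primitive `W` of the forcing leaves an equation with continuous forcing `L W`.
  obtain ⟨z, hz₀, hz⟩ := exists_hasDerivAt_eq_clm_add L (L.continuous.comp hW) x₀
  have hzc : Continuous z := continuous_iff_continuousAt.2 fun t => (hz t).continuousAt
  have hLc : Continuous fun s => L (z s + W s) := L.continuous.comp (hzc.add hW)
  have hzint : ∀ t, z t = x₀ + ∫ s in (0 : ℝ)..t, L (z s + W s) := fun t => by
    rw [intervalIntegral.integral_eq_sub_of_hasDerivAt
      (fun s _ => by simpa only [map_add, Function.comp_apply] using hz s)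
      (hLc.intervalIntegrable _ _), hz₀, add_sub_cancel]
  refine ⟨fun t => z t + W t, (hzc.add hW).continuousOn, fun t ht => ?_, fun t ht => ?_⟩
  · exact (hLc.intervalIntegrable 0 t).add (hg t ht)
  · rw [intervalIntegral.integral_add (hLc.intervalIntegrable 0 t) (hg t ht), ← hWg t ht,
      ← add_assoc, ← hzint]

theorem integrableOn_Ici_and_integral_le_of_forall_intervalIntegral_le {φ ρ : ℝ → ℝ} {c : ℝ}
    (hφ : ContinuousOn φ (Set.Ici 0)) (hφ₀ : ∀ t, 0 ≤ t → 0 ≤ φ t)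
    (hρ : IntegrableOn ρ (Set.Ici 0))
    (h : ∀ T, 0 ≤ T → ∫ t in (0 : ℝ)..T, φ t ≤ (∫ t in (0 : ℝ)..T, ρ t) + c) :
    IntegrableOn φ (Set.Ici 0) ∧
      ∫ t in Set.Ici (0 : ℝ), φ t ≤ (∫ t in Set.Ici (0 : ℝ), ρ t) + c := by
  rw [integrableOn_Ici_iff_integrableOn_Ioi] at hρ ⊢
  rw [integral_Ici_eq_integral_Ioi, integral_Ici_eq_integral_Ioi]
  have hlim := intervalIntegral_tendsto_integral_Ioi 0 hρ Filter.tendsto_id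
  have hint : IntegrableOn φ (Set.Ioi 0) := by
    refine integrableOn_Ioi_of_intervalIntegral_norm_bounded
      ((∫ t in Set.Ioi (0 : ℝ), ρ t) + 1 + c) 0 (fun T => ?_) Filter.tendsto_id ?_
    · exact ((hφ.mono Set.Icc_subset_Ici_self).integrableOn_Icc).mono_set Set.Ioc_subset_Icc_self
    · filter_upwards [hlim.eventually (gt_mem_nhds (lt_add_one _)), Filter.eventually_ge_atTop 0]
        with T hT hT₀
      have hnorm : ∫ t in (0 : ℝ)..T, ‖φ t‖ = ∫ t in (0 : ℝ)..T, φ t :=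
        intervalIntegral.integral_congr fun t ht =>
          Real.norm_of_nonneg (hφ₀ t (Set.uIcc_of_le hT₀ ▸ ht).1)
      simp only [id] at hT ⊢
      linarith [h T hT₀]
  refine ⟨hint, le_of_tendsto_of_tendsto
    (intervalIntegral_tendsto_integral_Ioi 0 hint Filter.tendsto_id) (hlim.add_const c) ?_⟩
  filter_upwards [Filter.eventually_ge_atTop 0] with T hT using h T hT

theorem IsCaratheodorySolution.integral_le_of_fderiv_add_le [CompleteSpace E] {G : ℝ → E → E}
    {x₀ : E} {x : ℝ → E} (hx : IsCaratheodorySolution G x₀ x) {V : E → ℝ} (hV : ContDiff ℝ 1 V)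
    (hV₀ : ∀ v, 0 ≤ V v) {φ ρ : ℝ → ℝ} (hφ : ContinuousOn φ (Set.Ici 0))
    (hφ₀ : ∀ t, 0 ≤ t → 0 ≤ φ t) (hρ : IntegrableOn ρ (Set.Ici 0))
    (hle : ∀ t, 0 ≤ t → fderiv ℝ V (x t) (G t (x t)) + φ t ≤ ρ t) :
    IntegrableOn φ (Set.Ici 0) ∧
      ∫ t in Set.Ici (0 : ℝ), φ t ≤ (∫ t in Set.Ici (0 : ℝ), ρ t) + V x₀ := by
  refine integrableOn_Ici_and_integral_le_of_forall_intervalIntegral_le hφ hφ₀ hρ fun T hT => ?_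
  obtain ⟨hVint, hVeq⟩ := intervalIntegrable_fderiv_and_integral_eq_sub
    (hx.intervalIntegrable T hT)
    (fun t ht => hx.apply_zero ▸ hx.eq_add_integral t (Set.uIcc_of_le hT ▸ ht).1) hV
  have hsub : Set.uIcc 0 T ⊆ Set.Ici 0 := Set.uIcc_of_le hT ▸ Set.Icc_subset_Ici_self
  have hφT : IntervalIntegrable φ volume 0 T := (hφ.mono hsub).intervalIntegrable
  have hρT : IntervalIntegrable ρ volume 0 T := (hρ.mono_set hsub).intervalIntegrable
  have hmono := intervalIntegral.integral_mono_on hT (hVint.add hφT) hρT fun t ht => hle t ht.1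
  rw [intervalIntegral.integral_add hVint hφT, hVeq, hx.apply_zero] at hmono
  linarith [hV₀ (x T)]

end Caratheodory

section QuadraticForm

variable {ι : Type*}

open scoped MatrixOrder in
theorem exists_pos_posSemidef_sub_smul_one [Finite ι] [DecidableEq ι] {M : Matrix ι ι ℝ}
    (hM : M.PosDef) : ∃ c : ℝ, 0 < c ∧ (M - c • 1).PosSemidef := by
  cases nonempty_fintype ι
  cases isEmpty_or_nonempty ι
  · exact ⟨1, one_pos, by rw [Subsingleton.elim (M - 1 • 1) 0]; exact .zero⟩
  obtain ⟨c, hc, hcM⟩ := (CFC.exists_pos_algebraMap_le_iff hM.1).2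
    fun _ => hM.isStrictlyPositive.spectrum_pos
  exact ⟨c, hc, by rwa [Matrix.le_iff, Algebra.algebraMap_eq_smul_one] at hcM⟩

variable [Fintype ι]

theorem dotProduct_ofLp_self (v : EuclideanSpace ℝ ι) : v.ofLp ⬝ᵥ v.ofLp = ‖v‖ ^ 2 := by
  rw [← real_inner_self_eq_norm_sq, EuclideanSpace.inner_eq_star_dotProduct, star_trivial]

theorem fderiv_dotProduct_mulVec (M : Matrix ι ι ℝ) (x h : EuclideanSpace ℝ ι) :
    fderiv ℝ (fun v : EuclideanSpace ℝ ι => v.ofLp ⬝ᵥ M *ᵥ v.ofLp) x h =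
      h.ofLp ⬝ᵥ M *ᵥ x.ofLp + x.ofLp ⬝ᵥ M *ᵥ h.ofLp := by
  classical
  simp only [← inner_toEuclideanCLM]
  rw [fderiv_inner_apply ℝ differentiableAt_fun_id (by fun_prop), add_comm]
  simp

theorem contDiff_dotProduct_mulVec (M : Matrix ι ι ℝ) {n : WithTop ℕ∞} :
    ContDiff ℝ n fun v : EuclideanSpace ℝ ι => v.ofLp ⬝ᵥ M *ᵥ v.ofLp := by
  classical
  simp only [← inner_toEuclideanCLM]
  exact contDiff_id.inner ℝ (toEuclideanCLM (𝕜 := ℝ) M).contDiff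

end QuadraticForm

section SquareIntegrable

variable {ι : Type} [Fintype ι]

theorem IsL2.integrableOn_norm_sq {u : ℝ → EuclideanSpace ℝ ι} (hu : IsL2 u) :
    IntegrableOn (fun t => ‖u t‖ ^ 2) (Set.Ici 0) :=
  (memLp_two_iff_integrable_sq_norm hu.1).1 hu

theorem IsL2.intervalIntegrable {u : ℝ → EuclideanSpace ℝ ι} (hu : IsL2 u) {t : ℝ}
    (ht : 0 ≤ t) : IntervalIntegrable u volume 0 t :=
  (intervalIntegrable_iff_integrableOn_Icc_of_le ht).2 <|
    (MemLp.mono_measure (Measure.restrict_mono Set.Icc_subset_Ici_self le_rfl) hu).integrable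
      one_le_two

theorem IsL2.toEuclideanLin {ω : Type} [Fintype ω] [DecidableEq ω] {w : ℝ → EuclideanSpace ℝ ω}
    (hw : IsL2 w) (M : Matrix ι ω ℝ) : IsL2 fun t => M.toEuclideanLin (w t) :=
  M.toEuclideanLin.toContinuousLinearMap.comp_memLp' hw

theorem IsL2.integrableOn_dotProduct_mulVec {u : ℝ → EuclideanSpace ℝ ι} (hu : IsL2 u)
    (M : Matrix ι ι ℝ) : IntegrableOn (fun t => (u t).ofLp ⬝ᵥ M *ᵥ (u t).ofLp) (Set.Ici 0) := by
  classical
  simp only [← inner_toEuclideanCLM]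
  exact memLp_one_iff_integrable.1 <|
    (innerSL ℝ).memLp_of_bilin (𝕜 := ℝ) 1 hu ((toEuclideanCLM (𝕜 := ℝ) M).comp_memLp' hu)

theorem isL2_of_integrableOn_dotProduct_mulVec {M : Matrix ι ι ℝ} (hM : M.PosDef)
    {z : ℝ → EuclideanSpace ℝ ι} (hz : AEStronglyMeasurable z (volume.restrict (Set.Ici 0)))
    (h : IntegrableOn (fun t => (z t).ofLp ⬝ᵥ M *ᵥ (z t).ofLp) (Set.Ici 0)) : IsL2 z := by
  classical
  obtain ⟨c, hc, hcM⟩ := exists_pos_posSemidef_sub_smul_one hM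
  refine (memLp_two_iff_integrable_sq_norm hz).2 ?_
  refine (h.const_mul c⁻¹).mono' (hz.norm.pow 2) (.of_forall fun t => ?_)
  have hle := hcM.dotProduct_mulVec_nonneg (z t).ofLp
  simp only [star_trivial, sub_mulVec, dotProduct_sub, smul_mulVec, one_mulVec, dotProduct_smul,
    smul_eq_mul, sub_nonneg] at hle
  rwa [Real.norm_of_nonneg (by positivity), le_inv_mul_iff₀ hc, ← dotProduct_ofLp_self]

end SquareIntegrable

section BoundedRealLemma

variable {ι ω κ : Type*} [Fintype ι]

/-- The matrix of the bounded real inequality in the variable `X` for the system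
`ẋ = A x + E w`, `z = C x` with supply rate `wᵀ Q w - zᵀ R⁻¹ z`. -/
def boundedRealMatrix (A : Matrix ι ι ℝ) (E : Matrix ι ω ℝ) (C : Matrix κ ι ℝ) (Q : Matrix ω ω ℝ)
    (R : Matrix κ κ ℝ) (X : Matrix ι ι ℝ) : Matrix ((ι ⊕ ω) ⊕ κ) ((ι ⊕ ω) ⊕ κ) ℝ :=
  fromBlocks (fromBlocks (A * X + (A * X)ᵀ) E Eᵀ (-Q)) (fromRows (C * X)ᵀ 0) (fromCols (C * X) 0)
    (-R)

variable {A : Matrix ι ι ℝ} {E : Matrix ι ω ℝ} {C : Matrix κ ι ℝ} {Q : Matrix ω ω ℝ}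
  {R : Matrix κ κ ℝ} {X : Matrix ι ι ℝ}

theorem exists_pos_posSemidef_neg_boundedRealMatrix [Finite ω] [DecidableEq ω] [Finite κ]
    (hM : (-boundedRealMatrix A E C Q R X).PosDef) :
    ∃ ε : ℝ, 0 < ε ∧ (-boundedRealMatrix A E C (Q - ε • 1) R X).PosSemidef := by
  classical
  cases nonempty_fintype ω
  cases nonempty_fintype κ
  obtain ⟨ε, hε, hle⟩ := exists_pos_posSemidef_sub_smul_one hM
  have hN : (diagonal (Sum.elim (Sum.elim 1 0) 1) : Matrix ((ι ⊕ ω) ⊕ κ) _ ℝ).PosSemidef :=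
    .diagonal fun i => by rcases i with (i | i) | i <;> simp
  refine ⟨ε, hε, ?_⟩
  convert hle.add (hN.smul hε.le) using 1
  ext i j
  rcases i with (i | i) | i <;> rcases j with (j | j) | j <;>
    simp [boundedRealMatrix, diagonal_apply, one_apply]

variable [Fintype ω] [Fintype κ]

theorem dotProduct_boundedRealMatrix_mulVec (v : ι → ℝ) (w : ω → ℝ) (z : κ → ℝ) :
    Sum.elim (Sum.elim v w) z ⬝ᵥ boundedRealMatrix A E C Q R X *ᵥ Sum.elim (Sum.elim v w) z =
      2 * (v ⬝ᵥ A *ᵥ X *ᵥ v) + 2 * (v ⬝ᵥ E *ᵥ w) + 2 * (z ⬝ᵥ C *ᵥ X *ᵥ v)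
        - w ⬝ᵥ Q *ᵥ w - z ⬝ᵥ R *ᵥ z := by
  have hA : v ⬝ᵥ (A * X)ᵀ *ᵥ v = v ⬝ᵥ (A * X) *ᵥ v := by
    rw [mulVec_transpose, dotProduct_comm, dotProduct_mulVec]
  have hE : w ⬝ᵥ Eᵀ *ᵥ v = v ⬝ᵥ E *ᵥ w := by
    rw [mulVec_transpose, dotProduct_comm, dotProduct_mulVec]
  have hC : v ⬝ᵥ (C * X)ᵀ *ᵥ z = z ⬝ᵥ (C * X) *ᵥ v := by
    rw [mulVec_transpose, dotProduct_comm, dotProduct_mulVec]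
  simp only [boundedRealMatrix, fromBlocks_mulVec, Sum.elim_comp_inl, Sum.elim_comp_inr,
    fromRows_mulVec, fromCols_mulVec_sumElim, sumElim_dotProduct_sumElim, dotProduct_add,
    add_mulVec, neg_mulVec, dotProduct_neg, zero_mulVec, dotProduct_zero, add_zero, hA, hE, hC]
  simp only [mulVec_mulVec]
  ring

theorem dissipation_of_posSemidef_neg_boundedRealMatrix [DecidableEq ι] [DecidableEq κ]
    (hX : X.IsHermitian) (hXdet : IsUnit X.det) (hRdet : IsUnit R.det)
    (hM : (-boundedRealMatrix A E C Q R X).PosSemidef) (x : ι → ℝ) (w : ω → ℝ) :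
    (A *ᵥ x + E *ᵥ w) ⬝ᵥ X⁻¹ *ᵥ x + x ⬝ᵥ X⁻¹ *ᵥ (A *ᵥ x + E *ᵥ w)
      + (C *ᵥ x) ⬝ᵥ R⁻¹ *ᵥ (C *ᵥ x) ≤ w ⬝ᵥ Q *ᵥ w := by
  have hXv : X *ᵥ X⁻¹ *ᵥ x = x := by
    rw [mulVec_mulVec, mul_nonsing_inv _ hXdet, one_mulVec]
  have hRz : R *ᵥ R⁻¹ *ᵥ C *ᵥ x = C *ᵥ x := by
    rw [mulVec_mulVec, mul_nonsing_inv _ hRdet, one_mulVec]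
  have hsymm (f : ι → ℝ) : x ⬝ᵥ X⁻¹ *ᵥ f = f ⬝ᵥ X⁻¹ *ᵥ x := by
    have hT : (X⁻¹)ᵀ = X⁻¹ := by simpa using hX.inv.eq
    rw [dotProduct_mulVec, ← mulVec_transpose, hT, dotProduct_comm]
  have h := hM.dotProduct_mulVec_nonneg
    (Sum.elim (Sum.elim (X⁻¹ *ᵥ x) w) (R⁻¹ *ᵥ C *ᵥ x))
  rw [star_trivial, neg_mulVec, dotProduct_neg, dotProduct_boundedRealMatrix_mulVec, hXv, hRz,
    dotProduct_comm (R⁻¹ *ᵥ C *ᵥ x)] at h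
  rw [hsymm, dotProduct_comm, dotProduct_add]
  linarith

end BoundedRealLemma

theorem IsCaratheodorySolution.isL2_and_integral_le {ι ω κ : Type} [Fintype ι] [Fintype ω]
    [Fintype κ] [DecidableEq ι] [DecidableEq ω] [DecidableEq κ] {A : Matrix ι ι ℝ}
    {E : Matrix ι ω ℝ} {C : Matrix κ ι ℝ} {Q : Matrix ω ω ℝ} {R : Matrix κ κ ℝ} {X : Matrix ι ι ℝ}
    (hX : X.PosDef) (hR : R.PosDef) (hM : (-boundedRealMatrix A E C Q R X).PosSemidef)
    {x₀ : EuclideanSpace ℝ ι} {x : ℝ → EuclideanSpace ℝ ι} {w : ℝ → EuclideanSpace ℝ ω}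
    (hw : IsL2 w)
    (hx : IsCaratheodorySolution (fun t v => A.toEuclideanLin v + E.toEuclideanLin (w t)) x₀ x) :
    IsL2 (fun t => C.toEuclideanLin (x t)) ∧
      ∫ t in Set.Ici (0 : ℝ), (C.toEuclideanLin (x t)).ofLp ⬝ᵥ
          R⁻¹ *ᵥ (C.toEuclideanLin (x t)).ofLp ≤
        (∫ t in Set.Ici (0 : ℝ), (w t).ofLp ⬝ᵥ Q *ᵥ (w t).ofLp) + x₀.ofLp ⬝ᵥ X⁻¹ *ᵥ x₀.ofLp := by
  have hz : ContinuousOn (fun t => C.toEuclideanLin (x t)) (Set.Ici 0) :=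
    C.toEuclideanLin.continuous_of_finiteDimensional.comp_continuousOn hx.continuousOn
  obtain ⟨hint, hle⟩ := hx.integral_le_of_fderiv_add_le
    (contDiff_dotProduct_mulVec X⁻¹)
    (fun v => by simpa using hX.inv.posSemidef.dotProduct_mulVec_nonneg v.ofLp)
    ((contDiff_dotProduct_mulVec (n := 0) R⁻¹).continuous.comp_continuousOn hz)
    (fun t _ => by
      simpa using hR.inv.posSemidef.dotProduct_mulVec_nonneg (C.toEuclideanLin (x t)).ofLp)
    (hw.integrableOn_dotProduct_mulVec Q)
    (fun t _ => by
      rw [fderiv_dotProduct_mulVec]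
      exact dissipation_of_posSemidef_neg_boundedRealMatrix hX.isHermitian hX.det_pos.ne'.isUnit
        hR.det_pos.ne'.isUnit hM (x t).ofLp (w t).ofLp)
  exact ⟨isL2_of_integrableOn_dotProduct_mulVec hR.inv
    (hz.aestronglyMeasurable measurableSet_Ici) hint, hle⟩

section Stack

variable {ι κ : Type}

theorem exists_eq_stack (x : ℝ → EuclideanSpace ℝ (ι ⊕ κ)) :
    ∃ (x₁ : ℝ → EuclideanSpace ℝ ι) (x₂ : ℝ → EuclideanSpace ℝ κ),
      x = fun t => stack (x₁ t) (x₂ t) := by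
  refine ⟨fun t => WithLp.toLp 2 fun i => x t (.inl i),
    fun t => WithLp.toLp 2 fun j => x t (.inr j), funext fun t => ?_⟩
  ext (i | j) <;> rfl

variable [Fintype ι] [Fintype κ]

theorem norm_sq_stack (x : EuclideanSpace ℝ ι) (y : EuclideanSpace ℝ κ) :
    ‖stack x y‖ ^ 2 = ‖x‖ ^ 2 + ‖y‖ ^ 2 := by
  simp [stack, EuclideanSpace.real_norm_sq_eq]

theorem isL2_stack_iff {u : ℝ → EuclideanSpace ℝ ι} {v : ℝ → EuclideanSpace ℝ κ} :
    IsL2 (fun t => stack (u t) (v t)) ↔ IsL2 u ∧ IsL2 v := by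
  let e := EuclideanSpace.sumEquivProd (𝕜 := ℝ) (ι := ι) (κ := κ)
  constructor
  · exact fun h => ⟨(ContinuousLinearMap.fst ℝ _ _ ∘L e.toContinuousLinearMap).comp_memLp' h,
      (ContinuousLinearMap.snd ℝ _ _ ∘L e.toContinuousLinearMap).comp_memLp' h⟩
  · intro ⟨hu, hv⟩
    have hmeas := e.symm.continuous.comp_aestronglyMeasurable (hu.1.prodMk hv.1)
    refine (memLp_two_iff_integrable_sq_norm hmeas).2 ?_
    exact (hu.integrableOn_norm_sq.add hv.integrableOn_norm_sq).congr
      (.of_forall fun t => (norm_sq_stack (u t) (v t)).symm)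

theorem IsCaratheodorySolution.of_stack
    {G : ℝ → EuclideanSpace ℝ (ι ⊕ κ) → EuclideanSpace ℝ (ι ⊕ κ)}
    {G₁ : ℝ → EuclideanSpace ℝ ι → EuclideanSpace ℝ ι}
    {G₂ : ℝ → EuclideanSpace ℝ κ → EuclideanSpace ℝ κ} {a : EuclideanSpace ℝ ι}
    {b : EuclideanSpace ℝ κ} {x : ℝ → EuclideanSpace ℝ ι} {y : ℝ → EuclideanSpace ℝ κ}
    (h : IsCaratheodorySolution G (stack a b) fun t => stack (x t) (y t))
    (hG : ∀ t, G t (stack (x t) (y t)) = stack (G₁ t (x t)) (G₂ t (y t))) :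
    IsCaratheodorySolution G₁ a x ∧ IsCaratheodorySolution G₂ b y := by
  let e := (EuclideanSpace.sumEquivProd (𝕜 := ℝ) (ι := ι) (κ := κ)).toContinuousLinearMap
  constructor
  · exact h.map (ContinuousLinearMap.fst ℝ _ _ ∘L e) fun t _ => by rw [hG]; rfl
  · exact h.map (ContinuousLinearMap.snd ℝ _ _ ∘L e) fun t _ => by rw [hG]; rfl

end Stack

section Composite

variable {n₁ n₂ m q₁ q₂ p : ℕ}

theorem IsCaratheodorySolution.isTrajectory {n q : ℕ} {S : LTISystem n m q p}
    {x₀ : EuclideanSpace ℝ (Fin n)} {u : ℝ → EuclideanSpace ℝ (Fin m)}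
    {d : ℝ → EuclideanSpace ℝ (Fin q)} {x : ℝ → EuclideanSpace ℝ (Fin n)}
    (hx : IsCaratheodorySolution (fun t v => S.vectorField v (u t) (d t)) x₀ x) :
    S.IsTrajectory x₀ u d x :=
  ⟨hx.continuousOn, hx.eq_add_integral⟩

theorem weightQ_sub_smul_one (γ δ μ ε : ℝ) :
    weightQ m q₁ γ δ μ - ε • 1 = weightQ m q₁ γ (δ - ε) (μ - ε) := by
  simp only [weightQ, ← fromBlocks_one, fromBlocks_smul, sub_eq_add_neg, fromBlocks_neg,
    fromBlocks_add, smul_zero, neg_zero, add_zero, add_smul, neg_smul, add_assoc]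

theorem weightR_posDef {η : ℝ} (hη : 0 < η) : (weightR p q₂ η).PosDef := by
  have h : weightR p q₂ η = diagonal (Sum.elim 1 fun _ => η) := by
    rw [weightR, ← fromBlocks_diagonal, ← smul_one_eq_diagonal]
    rfl
  rw [h, posDef_diagonal_iff]
  exact Sum.rec (fun _ => one_pos) fun _ => hη

theorem inv_weightR {η : ℝ} (hη : η ≠ 0) : (weightR p q₂ η)⁻¹ = weightR p q₂ η⁻¹ :=
  inv_eq_right_inv <| by simp [weightR, fromBlocks_multiply, smul_smul, hη]

theorem lmiMatrix_eq_boundedRealMatrix (S₁ : LTISystem n₁ m q₁ p) (S₂ : LTISystem n₂ m q₂ p)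
    (γ δ η μ : ℝ) {X : Matrix (Fin n₁ ⊕ Fin n₂) (Fin n₁ ⊕ Fin n₂) ℝ} (hX : IsUnit X.det)
    (P : Matrix (Fin q₂) (Fin n₁ ⊕ Fin n₂) ℝ) :
    lmiMatrix S₁ S₂ γ δ η μ X P =
      boundedRealMatrix (compositeA S₁ S₂ + compositeB S₁ S₂ * (P * X⁻¹)) (compositeE S₁ S₂)
        (compositeC S₁ S₂ + compositeD S₁ S₂ * (P * X⁻¹)) (weightQ m q₁ γ δ μ) (weightR p q₂ η)
        X := by
  simp only [lmiMatrix, boundedRealMatrix, Matrix.add_mul, Matrix.mul_assoc,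
    nonsing_inv_mul _ hX, Matrix.mul_one]

theorem closedLoop_vectorField_stack (S₁ : LTISystem n₁ m q₁ p) (S₂ : LTISystem n₂ m q₂ p)
    (F : Matrix (Fin q₂) (Fin n₁ ⊕ Fin n₂) ℝ) (x₁ : EuclideanSpace ℝ (Fin n₁))
    (x₂ : EuclideanSpace ℝ (Fin n₂)) (u₁ u₂ : EuclideanSpace ℝ (Fin m))
    (d₁ : EuclideanSpace ℝ (Fin q₁)) :
    (compositeA S₁ S₂ + compositeB S₁ S₂ * F).toEuclideanLin (stack x₁ x₂)
        + (compositeE S₁ S₂).toEuclideanLin (stack (stack u₁ u₂) d₁) =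
      stack (S₁.vectorField x₁ u₁ d₁)
        (S₂.vectorField x₂ u₂ (F.toEuclideanLin (stack x₁ x₂))) := by
  ext (i | i) <;>
    simp [stack, LTISystem.vectorField, compositeA, compositeB, compositeE, ← mulVec_mulVec,
      fromBlocks_mulVec, fromRows_mulVec] <;>
    ring

theorem closedLoop_output_stack (S₁ : LTISystem n₁ m q₁ p) (S₂ : LTISystem n₂ m q₂ p)
    (F : Matrix (Fin q₂) (Fin n₁ ⊕ Fin n₂) ℝ) (x₁ : EuclideanSpace ℝ (Fin n₁))
    (x₂ : EuclideanSpace ℝ (Fin n₂)) :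
    (compositeC S₁ S₂ + compositeD S₁ S₂ * F).toEuclideanLin (stack x₁ x₂) =
      stack (S₁.C.toEuclideanLin x₁ - S₂.C.toEuclideanLin x₂)
        (F.toEuclideanLin (stack x₁ x₂)) := by
  ext (i | i) <;>
    simp [stack, compositeC, compositeD, fromBlocks_mulVec, fromRows_mulVec, neg_mulVec,
      sub_eq_add_neg]

theorem dotProduct_weightQ_mulVec_stack (γ δ μ : ℝ) (u₁ u₂ : EuclideanSpace ℝ (Fin m))
    (d₁ : EuclideanSpace ℝ (Fin q₁)) :
    (stack (stack u₁ u₂) d₁).ofLp ⬝ᵥ weightQ m q₁ γ δ μ *ᵥ (stack (stack u₁ u₂) d₁).ofLp =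
      γ * ‖u₁ - u₂‖ ^ 2 + δ * ‖stack u₁ u₂‖ ^ 2 + μ * ‖d₁‖ ^ 2 := by
  rw [norm_sq_stack]
  simp only [← dotProduct_ofLp_self, weightQ, stack, fromBlocks_mulVec, Sum.elim_comp_inl,
    Sum.elim_comp_inr, sumElim_dotProduct_sumElim, dotProduct_add, zero_mulVec, dotProduct_zero,
    smul_mulVec, one_mulVec, neg_mulVec, dotProduct_neg, dotProduct_smul, smul_eq_mul,
    WithLp.ofLp_sub, sub_dotProduct, dotProduct_sub, dotProduct_comm u₂.ofLp u₁.ofLp]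
  ring

theorem dotProduct_weightR_mulVec_stack (η : ℝ) (y : EuclideanSpace ℝ (Fin p))
    (d₂ : EuclideanSpace ℝ (Fin q₂)) :
    (stack y d₂).ofLp ⬝ᵥ weightR p q₂ η *ᵥ (stack y d₂).ofLp = ‖y‖ ^ 2 + η * ‖d₂‖ ^ 2 := by
  simp [← dotProduct_ofLp_self, weightR, stack, fromBlocks_mulVec, smul_mulVec]

theorem integral_weightQ {u₁ u₂ : ℝ → EuclideanSpace ℝ (Fin m)}
    {d₁ : ℝ → EuclideanSpace ℝ (Fin q₁)} (γ δ μ : ℝ) (hu₁ : IsL2 u₁) (hu₂ : IsL2 u₂)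
    (hd₁ : IsL2 d₁) :
    ∫ t in Set.Ici (0 : ℝ), (stack (stack (u₁ t) (u₂ t)) (d₁ t)).ofLp ⬝ᵥ
        weightQ m q₁ γ δ μ *ᵥ (stack (stack (u₁ t) (u₂ t)) (d₁ t)).ofLp =
      γ * l2NormSq (fun t => u₁ t - u₂ t) + δ * l2NormSq (fun t => stack (u₁ t) (u₂ t))
        + μ * l2NormSq d₁ := by
  have hu : IntegrableOn (fun t => ‖u₁ t - u₂ t‖ ^ 2) (Set.Ici 0) :=
    IsL2.integrableOn_norm_sq (hu₁.sub hu₂)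
  have hs := (isL2_stack_iff.2 ⟨hu₁, hu₂⟩).integrableOn_norm_sq
  simp only [dotProduct_weightQ_mulVec_stack, l2NormSq]
  rw [integral_add ((hu.const_mul γ).fun_add (hs.const_mul δ))
    (hd₁.integrableOn_norm_sq.const_mul μ), integral_add (hu.const_mul γ) (hs.const_mul δ),
    integral_const_mul, integral_const_mul, integral_const_mul]

theorem integral_weightR {y : ℝ → EuclideanSpace ℝ (Fin p)} {d₂ : ℝ → EuclideanSpace ℝ (Fin q₂)}
    (η : ℝ) (hy : IsL2 y) (hd₂ : IsL2 d₂) :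
    ∫ t in Set.Ici (0 : ℝ), (stack (y t) (d₂ t)).ofLp ⬝ᵥ
        weightR p q₂ η *ᵥ (stack (y t) (d₂ t)).ofLp = l2NormSq y + η * l2NormSq d₂ := by
  simp only [dotProduct_weightR_mulVec_stack, l2NormSq]
  rw [integral_add hy.integrableOn_norm_sq (hd₂.integrableOn_norm_sq.const_mul η),
    integral_const_mul]

end Composite

theorem mainTheorem8 {n₁ n₂ m q₁ q₂ p : ℕ}
    (S₁ : LTISystem n₁ m q₁ p) (S₂ : LTISystem n₂ m q₂ p)
    (γ δ : ℝ) (hγ : 0 < γ) (hδ : 0 < δ)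
    (hLMI : ∃ (X : Matrix (Fin n₁ ⊕ Fin n₂) (Fin n₁ ⊕ Fin n₂) ℝ)
      (P : Matrix (Fin q₂) (Fin n₁ ⊕ Fin n₂) ℝ) (η μ : ℝ),
      X.PosDef ∧ 0 < η ∧ 0 < μ ∧ (-lmiMatrix S₁ S₂ γ δ η μ X P).PosDef) :
    IsSimilar S₁ S₂ γ δ := by
  obtain ⟨X, P, η, μ, hX, hη, hμ, hM⟩ := hLMI
  rw [lmiMatrix_eq_boundedRealMatrix _ _ _ _ _ _ hX.det_pos.ne'.isUnit] at hM
  obtain ⟨ε, hε, hMε⟩ := exists_pos_posSemidef_neg_boundedRealMatrix hM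
  rw [weightQ_sub_smul_one] at hMε
  refine ⟨ε, η⁻¹, μ, X⁻¹, hε, inv_pos.2 hη, hμ, hX.inv, fun x₁₀ x₂₀ u₁ u₂ d₁ hu₁ hu₂ hd₁ => ?_⟩
  have hw : IsL2 fun t => stack (stack (u₁ t) (u₂ t)) (d₁ t) :=
    isL2_stack_iff.2 ⟨isL2_stack_iff.2 ⟨hu₁, hu₂⟩, hd₁⟩
  obtain ⟨x, hx⟩ := exists_isCaratheodorySolution_clm_add
    (compositeA S₁ S₂ + compositeB S₁ S₂ * (P * X⁻¹)).toEuclideanLin.toContinuousLinearMap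
    (fun t => (hw.toEuclideanLin (compositeE S₁ S₂)).intervalIntegrable) (stack x₁₀ x₂₀)
  obtain ⟨x₁, x₂, rfl⟩ := exists_eq_stack x
  let d₂ := fun t => (P * X⁻¹).toEuclideanLin (stack (x₁ t) (x₂ t))
  obtain ⟨hx₁, hx₂⟩ := hx.of_stack (G₁ := fun t v => S₁.vectorField v (u₁ t) (d₁ t))
    (G₂ := fun t v => S₂.vectorField v (u₂ t) (d₂ t))
    fun t => closedLoop_vectorField_stack S₁ S₂ (P * X⁻¹) (x₁ t) (x₂ t) (u₁ t) (u₂ t) (d₁ t)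
  obtain ⟨hz, hle⟩ := IsCaratheodorySolution.isL2_and_integral_le hX (weightR_posDef hη) hMε hw hx
  simp only [closedLoop_output_stack] at hz hle
  obtain ⟨hy, hd₂⟩ := isL2_stack_iff.1 hz
  rw [inv_weightR hη.ne', integral_weightR _ hy hd₂, integral_weightQ _ _ _ hu₁ hu₂ hd₁] at hle
  refine ⟨d₂, x₁, x₂, hd₂, hx₁.isTrajectory, hx₂.isTrajectory, hy, ?_⟩
  simp only [LTISystem.output]
  linarith
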